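/- Let $(F,g_F)$ be a compact connected smooth Riemannian manifold without boundary, let $f\colon F\to(0,\infty)$ be smooth, let $I=(t_1,t_2)$ with $-\infty\le t_1<t_2\le\infty$, and let $M=I_f\times F$ be the standard static space-time, i.e. the product manifold $I\times F$ furnished with the Lorentzian metric $g=-f^2\,\mathrm dt^2\oplus g_F$. Then $(M,g)$ satisfies the strong energy condition ($\mathrm{Ric}(x,x)\ge 0$ for all causal tangent vectors $x$, i.e. all nonzero $x$ with $g(x,x)\le 0$) if and only if it satisfies the timelike convergence condition ($\mathrm{Ric}(x,x)\ge 0$ for all timelike tangent vectors $x$, i.e. all $x$ with $g(x,x)<0$); and if $(M,g)$ satisfies these equivalent conditions, then $f$ is a positive constant. Here $\mathrm{Ric}$ is the Ricci tensor of $g$, with the sign convention for which round spheres have positive Ricci curvature. -/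

import Mathlib

open scoped Manifold ContDiff Topology Bundle

noncomputable section

namespace StaticSpacetime

section Coordinates

variable {V : Type*} [NormedAddCommGroup V] [NormedSpace ℝ V]
  {ι : Type*} [Fintype ι] [DecidableEq ι]

/-- Christoffel symbols `Γ^k_{ij}` at the point `y` of a metric with components `G y i j` in the
linear coordinates of `V` given by the basis `b`:
`Γ^k_{ij} = (1/2) ∑_l g^{kl} (∂_i g_{jl} + ∂_j g_{il} - ∂_l g_{ij})`. -/
def christoffel (b : Module.Basis ι ℝ V) (G : V → Matrix ι ι ℝ) (k i j : ι) (y : V) : ℝ :=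
  (1 / 2) * ∑ l, (G y)⁻¹ k l *
    (fderiv ℝ (fun z => G z j l) y (b i) + fderiv ℝ (fun z => G z i l) y (b j)
      - fderiv ℝ (fun z => G z i j) y (b l))

/-- Components of the Ricci tensor (with the sign for which round spheres have positive Ricci
curvature):
`R_{jk} = ∑_i (∂_i Γ^i_{jk} - ∂_j Γ^i_{ik}) + ∑_{i,l} (Γ^i_{il} Γ^l_{jk} - Γ^i_{jl} Γ^l_{ik})`. -/
def ricciCoord (b : Module.Basis ι ℝ V) (G : V → Matrix ι ι ℝ) (y : V) (j k : ι) : ℝ :=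
  ∑ i, (fderiv ℝ (christoffel b G i j k) y (b i) - fderiv ℝ (christoffel b G i i k) y (b j))
    + ∑ i, ∑ l, (christoffel b G i i l y * christoffel b G l j k y
      - christoffel b G i j l y * christoffel b G l i k y)

end Coordinates

section Manifold

variable {E : Type*} [NormedAddCommGroup E] [NormedSpace ℝ E]
  {ι : Type*} [Fintype ι] [DecidableEq ι] (b : Module.Basis ι ℝ E)
  {H : Type*} [TopologicalSpace H] (I : ModelWithCorners ℝ E H)
  {M : Type*} [TopologicalSpace M] [ChartedSpace H M]

/-- The components `g_{ij} = g(∂_i, ∂_j)` of the tensor field `g` in the chart `e`, as functions of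
the coordinates; `∂_i` is the image of the basis vector `b i` under the derivative of the inverse
chart. -/
def metricInChart (g : ∀ p : M, TangentSpace I p →L[ℝ] TangentSpace I p →L[ℝ] ℝ)
    (e : OpenPartialHomeomorph M H) (y : E) : Matrix ι ι ℝ := fun i j =>
  g ((e.extend I).symm y) (mfderiv 𝓘(ℝ, E) I (e.extend I).symm y (b i))
    (mfderiv 𝓘(ℝ, E) I (e.extend I).symm y (b j))

/-- The value `Ric(v, w) = ∑_{j,k} R_{jk} v^j w^k` at the point `p` of the Ricci tensor of `g`,
computed in the coordinates of the chart `e` around `p`. By tensoriality, the value does not depend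
on the smooth chart (nor on the basis `b` of the model space). -/
def ricci (g : ∀ p : M, TangentSpace I p →L[ℝ] TangentSpace I p →L[ℝ] ℝ)
    (e : OpenPartialHomeomorph M H) (p : M) (v w : TangentSpace I p) : ℝ :=
  ∑ j, ∑ k, ricciCoord b (metricInChart b I g e) (e.extend I p) j k
    * b.repr (mfderiv I 𝓘(ℝ, E) (e.extend I) p v) j
    * b.repr (mfderiv I 𝓘(ℝ, E) (e.extend I) p w) k

/-- Timelike tangent vectors. -/
def IsTimelike (g : ∀ p : M, TangentSpace I p →L[ℝ] TangentSpace I p →L[ℝ] ℝ)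
    (p : M) (v : TangentSpace I p) : Prop :=
  g p v v < 0

/-- Causal (nonzero, timelike or null) tangent vectors. -/
def IsCausal (g : ∀ p : M, TangentSpace I p →L[ℝ] TangentSpace I p →L[ℝ] ℝ)
    (p : M) (v : TangentSpace I p) : Prop :=
  v ≠ 0 ∧ g p v v ≤ 0

/-- Strong energy condition: `Ric(v, v) ≥ 0` for all causal tangent vectors `v`, where the Ricci
tensor may be computed in any smooth chart around the base point. -/
def StrongEnergyCondition
    (g : ∀ p : M, TangentSpace I p →L[ℝ] TangentSpace I p →L[ℝ] ℝ) : Prop :=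
  ∀ (p : M) (v : TangentSpace I p), IsCausal I g p v →
    ∀ e ∈ IsManifold.maximalAtlas I ∞ M, p ∈ e.source → 0 ≤ ricci b I g e p v v

/-- Timelike convergence condition: `Ric(v, v) ≥ 0` for all timelike tangent vectors `v`. -/
def TimelikeConvergenceCondition
    (g : ∀ p : M, TangentSpace I p →L[ℝ] TangentSpace I p →L[ℝ] ℝ) : Prop :=
  ∀ (p : M) (v : TangentSpace I p), IsTimelike I g p v →
    ∀ e ∈ IsManifold.maximalAtlas I ∞ M, p ∈ e.source → 0 ≤ ricci b I g e p v v

end Manifold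

/-- The open interval `(t₁, t₂)` of real numbers, with possibly infinite end points, as an open
submanifold of `ℝ`. -/
def openInterval (t₁ t₂ : EReal) : TopologicalSpace.Opens ℝ :=
  ⟨{t | t₁ < (t : EReal) ∧ (t : EReal) < t₂},
    (isOpen_lt continuous_const continuous_coe_real_ereal).inter
      (isOpen_lt continuous_coe_real_ereal continuous_const)⟩

/-- The basis `∂_t, ∂_1, …, ∂_s` of the model space `ℝ × ℝ^s` of the product `(t₁, t₂) × F`. -/
def staticBasis (s : ℕ) : Module.Basis (Unit ⊕ Fin s) ℝ (ℝ × EuclideanSpace ℝ (Fin s)) :=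
  (Module.Basis.singleton Unit ℝ).prod (EuclideanSpace.basisFun (Fin s) ℝ).toBasis

/-- The metric `-f² dt² ⊕ g_F`, i.e. `σ^* g_F - (f ∘ σ)² dt ⊗ dt`, on the product `(t₁, t₂) × F`. -/
def staticMetric {s : ℕ} {F : Type*} [TopologicalSpace F]
    [ChartedSpace (EuclideanSpace ℝ (Fin s)) F] [IsManifold (𝓡 s) ∞ F]
    (t₁ t₂ : EReal) (f : F → ℝ)
    (gF : Bundle.ContMDiffRiemannianMetric (𝓡 s) ∞ (EuclideanSpace ℝ (Fin s))
      (fun x : F => TangentSpace (𝓡 s) x))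
    (p : openInterval t₁ t₂ × F) :
    TangentSpace (𝓘(ℝ, ℝ).prod (𝓡 s)) p →L[ℝ] TangentSpace (𝓘(ℝ, ℝ).prod (𝓡 s)) p →L[ℝ] ℝ :=
  let dt : TangentSpace (𝓘(ℝ, ℝ).prod (𝓡 s)) p →L[ℝ] ℝ :=
    mfderiv (𝓘(ℝ, ℝ).prod (𝓡 s)) 𝓘(ℝ, ℝ)
      (fun q : openInterval t₁ t₂ × F => ((q.1 : openInterval t₁ t₂) : ℝ)) p
  let dσ : TangentSpace (𝓘(ℝ, ℝ).prod (𝓡 s)) p →L[ℝ] TangentSpace (𝓡 s) p.2 :=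
    mfderiv (𝓘(ℝ, ℝ).prod (𝓡 s)) (𝓡 s) (Prod.snd : openInterval t₁ t₂ × F → F) p
  (ContinuousLinearMap.precomp ℝ dσ) ∘L (gF.inner p.2) ∘L dσ - (f p.2 ^ 2) • dt.smulRight dt

end StaticSpacetime

end

/-! On the static space-time, the vector field `∂_t` is timelike and `Ric(∂_t, ∂_t) = f Δf`, where
`Δ` is the Laplace–Beltrami operator of `g_F`. The timelike convergence condition therefore makes
`f` subharmonic, and Hopf's strong maximum principle shows that the set where `f` attains its
maximum is open; it is also closed, so it is all of `F`. The two energy conditions agree because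
`Ric(v, v)` is continuous in `v` and every causal vector `v` is a limit of timelike vectors
`v + ε w` with `w` timelike and in the same time cone as `v`. -/

namespace StaticSpacetime

section SecondDerivative

variable {V : Type*} [NormedAddCommGroup V] [NormedSpace ℝ V] {f g : V → ℝ} {x : V}

theorem differentiableAt_fderiv (hf : ContDiffAt ℝ 2 f x) : DifferentiableAt ℝ (fderiv ℝ f) x :=
  (hf.fderiv_right (m := 1) (by norm_num)).differentiableAt one_ne_zero

theorem eventually_differentiableAt (hf : ContDiffAt ℝ 2 f x) :
    ∀ᶠ y in 𝓝 x, DifferentiableAt ℝ f y :=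
  (hf.eventually (by simp)).mono fun _ hy => hy.differentiableAt two_ne_zero

theorem fderiv_fderiv_apply (hf : ContDiffAt ℝ 2 f x) (v w : V) :
    fderiv ℝ (fun z => fderiv ℝ f z w) x v = fderiv ℝ (fderiv ℝ f) x v w := by
  simp [fderiv_clm_apply (differentiableAt_fderiv hf) (differentiableAt_const w)]

theorem fderiv_fderiv_add (hf : ContDiffAt ℝ 2 f x) (hg : ContDiffAt ℝ 2 g x) :
    fderiv ℝ (fderiv ℝ (f + g)) x = fderiv ℝ (fderiv ℝ f) x + fderiv ℝ (fderiv ℝ g) x := by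
  have heq : fderiv ℝ (f + g) =ᶠ[𝓝 x] fderiv ℝ f + fderiv ℝ g := by
    filter_upwards [eventually_differentiableAt hf, eventually_differentiableAt hg] with y hfy hgy
    exact fderiv_add hfy hgy
  rw [heq.fderiv_eq, fderiv_add (differentiableAt_fderiv hf) (differentiableAt_fderiv hg)]

theorem fderiv_fderiv_const_smul (a : ℝ) (f : V → ℝ) (x : V) :
    fderiv ℝ (fderiv ℝ (a • f)) x = a • fderiv ℝ (fderiv ℝ f) x := by
  have heq : fderiv ℝ (a • f) = a • fderiv ℝ f := funext fun y => by
    simp [fderiv_const_smul_field]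
  rw [heq]
  exact congrFun (fderiv_const_smul_field (f := fderiv ℝ f) a) x

theorem fderiv_fderiv_sq_apply (hf : ContDiffAt ℝ 2 f x) (v w : V) :
    fderiv ℝ (fderiv ℝ (f ^ 2)) x v w
      = 2 * f x * fderiv ℝ (fderiv ℝ f) x v w + 2 * (fderiv ℝ f x v * fderiv ℝ f x w) := by
  have heq : fderiv ℝ (f ^ 2) =ᶠ[𝓝 x] fun y => (2 * f y) • fderiv ℝ f y := by
    filter_upwards [eventually_differentiableAt hf] with y hy
    simp [fderiv_pow 2 hy]
  have hfx := hf.differentiableAt two_ne_zero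
  rw [heq.fderiv_eq, fderiv_fun_smul (hfx.const_mul 2) (differentiableAt_fderiv hf),
    fderiv_const_mul hfx]
  simp [mul_assoc]

theorem deriv_deriv_comp_add_smul (hf : ContDiffAt ℝ 2 f x) (v : V) :
    deriv (deriv fun t : ℝ => f (x + t • v)) 0 = fderiv ℝ (fderiv ℝ f) x v v := by
  have hline (t : ℝ) : HasDerivAt (fun t : ℝ => x + t • v) v t := by
    simpa using ((hasDerivAt_id t).smul_const v).const_add x
  have hx : x + (0 : ℝ) • v = x := by simp
  have htendsto : Filter.Tendsto (fun t : ℝ => x + t • v) (𝓝 0) (𝓝 x) := by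
    simpa only [hx] using (hline 0).continuousAt.tendsto
  have hfirst : deriv (fun t : ℝ => f (x + t • v)) =ᶠ[𝓝 0] fun t => fderiv ℝ f (x + t • v) v := by
    filter_upwards [htendsto.eventually (eventually_differentiableAt hf)] with t ht
    exact (ht.hasFDerivAt.comp_hasDerivAt t (hline t)).deriv
  have hsecond : HasFDerivAt (fun y => fderiv ℝ f y v)
      (fderiv ℝ (fun y => fderiv ℝ f y v) x) (x + (0 : ℝ) • v) := by
    rw [hx]
    exact ((differentiableAt_fderiv hf).clm_apply (differentiableAt_const v)).hasFDerivAt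
  rw [hfirst.deriv_eq, ← fderiv_fderiv_apply hf]
  exact (hsecond.comp_hasDerivAt 0 (hline 0)).deriv

theorem deriv_deriv_nonpos_of_isLocalMax {φ : ℝ → ℝ} {t : ℝ} (hmax : IsLocalMax φ t)
    (hφ : ContinuousAt φ t) : deriv (deriv φ) t ≤ 0 := by
  by_contra! hpos
  have hmin : IsLocalMin φ t := isLocalMin_of_deriv_deriv_pos hpos hmax.deriv_eq_zero hφ
  have hconst : φ =ᶠ[𝓝 t] fun _ => φ t := by
    filter_upwards [hmax, hmin] with s hle hge using le_antisymm hle hge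
  simp [hconst.deriv.deriv_eq] at hpos

theorem fderiv_fderiv_nonpos_of_isLocalMax (hf : ContDiffAt ℝ 2 f x) (hmax : IsLocalMax f x)
    (v : V) : fderiv ℝ (fderiv ℝ f) x v v ≤ 0 := by
  have hx : x + (0 : ℝ) • v = x := by simp
  have hline : Filter.Tendsto (fun t : ℝ => x + t • v) (𝓝 0) (𝓝 x) := by
    simpa only [hx] using
      (show ContinuousAt (fun t : ℝ => x + t • v) 0 by fun_prop).tendsto
  rw [← deriv_deriv_comp_add_smul hf v]
  refine deriv_deriv_nonpos_of_isLocalMax ?_ ?_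
  · filter_upwards [hline.eventually hmax] with t ht
    rwa [hx]
  · simpa only [ContinuousAt, hx, Function.comp_def] using hf.continuousAt.tendsto.comp hline

end SecondDerivative

section SecondOrderOperator

variable {V : Type*} [NormedAddCommGroup V] [NormedSpace ℝ V] {ι : Type*} [Fintype ι]

/-- The value at `x` of the second order linear operator `∑ A_{il} ∂_i ∂_l f + ∑ c_l ∂_l f`, where
`A` and `c` are the values of its coefficients at `x` and `∂_i` is the derivative along `b i`. -/
noncomputable def secondOrderOp (b : ι → V) (A : Matrix ι ι ℝ) (c : ι → ℝ) (f : V → ℝ) (x : V) :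
    ℝ :=
  ∑ i, ∑ l, A i l * fderiv ℝ (fderiv ℝ f) x (b i) (b l) + ∑ l, c l * fderiv ℝ f x (b l)

variable {b : ι → V} {A : Matrix ι ι ℝ} {c : ι → ℝ} {f g : V → ℝ} {x : V}

theorem secondOrderOp_add (hf : ContDiffAt ℝ 2 f x) (hg : ContDiffAt ℝ 2 g x) :
    secondOrderOp b A c (f + g) x = secondOrderOp b A c f x + secondOrderOp b A c g x := by
  simp only [secondOrderOp, fderiv_fderiv_add hf hg,
    fderiv_add (hf.differentiableAt two_ne_zero) (hg.differentiableAt two_ne_zero), add_apply,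
    mul_add, Finset.sum_add_distrib]
  ring

theorem secondOrderOp_const_smul (a : ℝ) (f : V → ℝ) (x : V) :
    secondOrderOp b A c (a • f) x = a * secondOrderOp b A c f x := by
  have hfirst : fderiv ℝ (a • f) x = a • fderiv ℝ f x := congrFun (fderiv_const_smul_field a) x
  rw [secondOrderOp, fderiv_fderiv_const_smul, hfirst]
  simp only [secondOrderOp, smul_apply, smul_eq_mul, mul_left_comm _ a, ← Finset.mul_sum, mul_add]

theorem secondOrderOp_sq (hf : ContDiffAt ℝ 2 f x) :
    secondOrderOp b A c (f ^ 2) x = 2 * f x * secondOrderOp b A c f x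
      + 2 * ((fun i => fderiv ℝ f x (b i)) ⬝ᵥ A.mulVec fun l => fderiv ℝ f x (b l)) := by
  have hfirst : fderiv ℝ (f ^ 2) x = (2 * f x) • fderiv ℝ f x := by
    simp [fderiv_pow 2 (hf.differentiableAt two_ne_zero)]
  simp only [secondOrderOp, fderiv_fderiv_sq_apply hf, hfirst, smul_apply, smul_eq_mul, dotProduct,
    Matrix.mulVec, mul_add, Finset.sum_add_distrib, Finset.mul_sum]
  rw [add_right_comm]
  congr 1
  · congr 1
    · exact Finset.sum_congr rfl fun i _ => Finset.sum_congr rfl fun l _ => by ring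
    · exact Finset.sum_congr rfl fun l _ => by ring
  · exact Finset.sum_congr rfl fun i _ => Finset.sum_congr rfl fun l _ => by ring

open scoped MatrixOrder Matrix.Norms.L2Operator in
/-- Writing `A = Bᵀ B` turns the second order part into a sum of second derivatives along the
vectors `∑ i, B k i • b i`. -/
theorem secondOrderOp_nonpos_of_isLocalMax (hA : A.PosSemidef) (hf : ContDiffAt ℝ 2 f x)
    (hmax : IsLocalMax f x) : secondOrderOp b A c f x ≤ 0 := by
  classical
  obtain ⟨B, rfl⟩ : ∃ B : Matrix ι ι ℝ, A = B.conjTranspose * B :=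
    CStarAlgebra.nonneg_iff_eq_star_mul_self.mp hA.nonneg
  have hsum : secondOrderOp b (B.conjTranspose * B) c f x
      = ∑ k, fderiv ℝ (fderiv ℝ f) x (∑ i, B k i • b i) (∑ i, B k i • b i) := by
    simp only [secondOrderOp, hmax.fderiv_eq_zero, Matrix.mul_apply, Matrix.conjTranspose_apply,
      star_trivial, map_sum, map_smul, sum_apply, smul_apply, smul_eq_mul, zero_apply, mul_zero,
      Finset.sum_const_zero, add_zero, Finset.sum_mul, Finset.mul_sum]
    rw [Finset.sum_comm_cycle]
    refine Finset.sum_congr rfl fun k _ => Finset.sum_comm.trans ?_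
    exact Finset.sum_congr rfl fun i _ => Finset.sum_congr rfl fun l _ => by ring
  rw [hsum]
  exact Finset.sum_nonpos fun k _ => fderiv_fderiv_nonpos_of_isLocalMax hf hmax _

theorem continuousAt_secondOrderOp {A : V → Matrix ι ι ℝ} {c : V → ι → ℝ}
    (hA : ContinuousAt A x) (hc : ContinuousAt c x) (hf : ContDiffAt ℝ 2 f x) :
    ContinuousAt (fun y => secondOrderOp b (A y) (c y) f y) x := by
  have hfirst : ContinuousAt (fderiv ℝ f) x :=
    (hf.fderiv_right (m := 1) (by norm_num)).continuousAt
  have hsecond : ContinuousAt (fderiv ℝ (fderiv ℝ f)) x :=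
    ((hf.fderiv_right (m := 1) (by norm_num)).fderiv_right (m := 0) (by norm_num)).continuousAt
  refine (tendsto_finsetSum _ fun i _ => tendsto_finsetSum _ fun l _ => ?_).add
    (tendsto_finsetSum _ fun l _ => ?_)
  · exact ((continuousAt_pi.1 (continuousAt_pi.1 hA i) l).mul
      ((hsecond.clm_apply continuousAt_const).clm_apply continuousAt_const)).tendsto
  · exact ((continuousAt_pi.1 hc l).mul (hfirst.clm_apply continuousAt_const)).tendsto

/-- The square of `u` is added because `L(u²) = 2 ⟨A ∇u, ∇u⟩ > 0` where `u` vanishes. -/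
theorem exists_secondOrderOp_add_smul_sq_pos {u : V → ℝ} (hA : A.PosDef) (hu : ContDiffAt ℝ 2 u x)
    (hux : u x = 0) (hdu : (fun i => fderiv ℝ u x (b i)) ≠ 0) :
    ∃ k : ℝ, 0 < secondOrderOp b A c (u + k • u ^ 2) x := by
  have hsq : 0 < secondOrderOp b A c (u ^ 2) x := by
    have hquad := hA.dotProduct_mulVec_pos hdu
    rw [star_trivial] at hquad
    rw [secondOrderOp_sq hu, hux]
    linarith
  set k := (1 - secondOrderOp b A c u x) / secondOrderOp b A c (u ^ 2) x with hk
  have hsmul : ContDiffAt ℝ 2 (k • u ^ 2) x := contDiffAt_const.smul (hu.pow 2)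
  refine ⟨k, ?_⟩
  rw [secondOrderOp_add hu hsmul, secondOrderOp_const_smul, hk, div_mul_cancel₀ _ hsq.ne']
  linarith

end SecondOrderOperator

section MaximumPrinciple

theorem exists_pos_forall_add_mul_neg {X : Type*} [TopologicalSpace X] {K : Set X}
    (hK : IsCompact K) {g w : X → ℝ} (hg : ContinuousOn g K) (hw : ContinuousOn w K)
    (hle : ∀ y ∈ K, g y ≤ 0) (hlt : ∀ y ∈ K, 0 ≤ w y → g y < 0) :
    ∃ ε : ℝ, 0 < ε ∧ ∀ y ∈ K, g y + ε * w y < 0 := by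
  suffices h : ∀ᶠ ε : ℝ in 𝓝[>] 0, ∀ y ∈ K, g y + ε * w y < 0 from
    (h.and self_mem_nhdsWithin).exists.imp fun ε hε => ⟨hε.2, hε.1⟩
  refine hK.induction_on (by simp) (fun S T hST hT => hT.mono fun ε h y hy => h y (hST hy))
    (fun S T hS hT => hS.and hT |>.mono fun ε h y hy => hy.elim (h.1 y) (h.2 y)) fun y hy => ?_
  rcases lt_or_ge (w y) 0 with hwy | hwy
  · refine ⟨{x | x ∈ K ∧ w x < 0},
      Filter.inter_mem self_mem_nhdsWithin ((hw y hy).eventually_lt_const hwy), ?_⟩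
    filter_upwards [self_mem_nhdsWithin] with ε hε x hx
    linarith [hle x hx.1, mul_neg_of_pos_of_neg hε hx.2]
  · have htendsto : Filter.Tendsto (fun p : ℝ × X => g p.2 + p.1 * w p.2)
        (𝓝[>] 0 ×ˢ 𝓝[K] y) (𝓝 (g y + 0 * w y)) :=
      ((hg y hy).tendsto.comp Filter.tendsto_snd).add
        ((tendsto_nhdsWithin_of_tendsto_nhds Filter.tendsto_id |>.comp Filter.tendsto_fst).mul
          ((hw y hy).tendsto.comp Filter.tendsto_snd))
    obtain ⟨p, hp, q, hq, hpq⟩ := Filter.eventually_prod_iff.1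
      (htendsto.eventually_lt_const (by simpa using hlt y hy hwy))
    exact ⟨{x | q x}, hq, hp.mono fun ε hε x hx => hpq hε hx⟩

theorem exists_isLocalMax_add_smul {X : Type*} [PseudoMetricSpace X] [ProperSpace X]
    {f w : X → ℝ} {z : X} {δ : ℝ} (hδ : 0 < δ) (hf : ContinuousOn f (Metric.closedBall z δ))
    (hw : ContinuousOn w (Metric.closedBall z δ)) (hmax : ∀ y ∈ Metric.closedBall z δ, f y ≤ f z)
    (hwz : w z = 0) (hlt : ∀ y ∈ Metric.sphere z δ, 0 ≤ w y → f y < f z) :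
    ∃ ε : ℝ, 0 < ε ∧ ∃ y ∈ Metric.ball z δ, IsLocalMax (f + ε • w) y := by
  have hsphere := Metric.sphere_subset_closedBall (x := z) (ε := δ)
  obtain ⟨ε, hε, hneg⟩ := exists_pos_forall_add_mul_neg (isCompact_sphere z δ)
    (g := fun y => f y - f z) ((hf.sub continuousOn_const).mono hsphere) (hw.mono hsphere)
    (fun y hy => sub_nonpos.2 (hmax y (hsphere hy))) (fun y hy hwy => sub_neg.2 (hlt y hy hwy))
  obtain ⟨y, hy, hymax⟩ := (isCompact_closedBall z δ).exists_isMaxOn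
    ⟨z, Metric.mem_closedBall_self hδ.le⟩ (hf.add (hw.const_smul ε))
  have hyz : f z ≤ f y + ε * w y := by
    simpa [hwz] using hymax (Metric.mem_closedBall_self hδ.le)
  have hyball : y ∈ Metric.ball z δ :=
    lt_of_le_of_ne hy fun hsph => by linarith [hneg y hsph]
  exact ⟨ε, hε, y, hyball, hymax.isLocalMax
    (Filter.mem_of_superset (Metric.isOpen_ball.mem_nhds hyball) Metric.ball_subset_closedBall)⟩

theorem exists_ne_eq_of_secondOrderOp_nonneg {V : Type*} [NormedAddCommGroup V] [NormedSpace ℝ V]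
    [FiniteDimensional ℝ V] {ι : Type*} [Fintype ι] {b : ι → V} {A : V → Matrix ι ι ℝ}
    {c : V → ι → ℝ} {f u : V → ℝ} {z : V} {U : Set V} (hU : U ∈ 𝓝 z) (hA : ContinuousAt A z)
    (hc : ContinuousAt c z) (hpd : ∀ y ∈ U, (A y).PosDef) (hf : ∀ y ∈ U, ContDiffAt ℝ 2 f y)
    (hL : ∀ y ∈ U, 0 ≤ secondOrderOp b (A y) (c y) f y) (hmax : ∀ y ∈ U, f y ≤ f z)
    (hu : ContDiff ℝ 2 u) (huz : u z = 0) (hdu : (fun i => fderiv ℝ u z (b i)) ≠ 0) :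
    ∃ y ∈ U, 0 ≤ u y ∧ y ≠ z ∧ f y = f z := by
  by_contra! hne
  obtain ⟨k, hk⟩ := exists_secondOrderOp_add_smul_sq_pos (c := c z) (hpd z (mem_of_mem_nhds hU))
    hu.contDiffAt huz hdu
  set w : V → ℝ := u + k • u ^ 2 with hw
  have hwC : ContDiff ℝ 2 w := hu.add (contDiff_const.smul (hu.pow 2))
  have hfactor (y : V) : w y = u y * (1 + k * u y) := by
    simp only [hw, Pi.add_apply, Pi.smul_apply, Pi.pow_apply, smul_eq_mul]
    ring
  have hLw : ∀ᶠ y in 𝓝 z, 0 < secondOrderOp b (A y) (c y) w y :=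
    (continuousAt_secondOrderOp hA hc hwC.contDiffAt).eventually_const_lt hk
  have hsign : ∀ᶠ y in 𝓝 z, 0 < 1 + k * u y :=
    (continuous_const.add (hu.continuous.const_mul k)).continuousAt.eventually_const_lt
      (by simp [huz])
  obtain ⟨δ, hδ, hball⟩ := Metric.nhds_basis_closedBall.mem_iff.1
    (Filter.inter_mem hU (hLw.and hsign))
  obtain ⟨ε, hε, y, hy, hlocal⟩ := exists_isLocalMax_add_smul hδ
    (fun y hy => (hf y (hball hy).1).continuousAt.continuousWithinAt) hwC.continuous.continuousOn
    (fun y hy => hmax y (hball hy).1) (by simp [hfactor, huz]) fun y hy hwy => by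
      obtain ⟨hyU, -, hpos⟩ := hball (Metric.sphere_subset_closedBall hy)
      have huy : 0 ≤ u y := nonneg_of_mul_nonneg_left (hfactor y ▸ hwy) hpos
      exact (hmax y hyU).lt_of_ne (hne y hyU huy (Metric.ne_of_mem_sphere hy hδ.ne'))
  obtain ⟨hyU, hLwy, -⟩ := hball (Metric.ball_subset_closedBall hy)
  have hsmul : ContDiffAt ℝ 2 (ε • w) y := contDiffAt_const.smul hwC.contDiffAt
  have hsum : ContDiffAt ℝ 2 (f + ε • w) y := (hf y hyU).add hsmul
  have hnonpos := secondOrderOp_nonpos_of_isLocalMax (b := b) (c := c y) (hpd y hyU).posSemidef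
    hsum hlocal
  rw [secondOrderOp_add (hf y hyU) hsmul, secondOrderOp_const_smul] at hnonpos
  linarith [hL y hyU, mul_pos hε hLwy]

theorem exists_closest_point_of_notMem_nhds {X : Type*} [PseudoMetricSpace X] {Z : Set X} {x₀ : X}
    {R : ℝ} (hR : 0 < R) (hZ : IsCompact (Metric.closedBall x₀ R ∩ Z)) (hx₀ : x₀ ∈ Z)
    (hnhds : Z ∉ 𝓝 x₀) :
    ∃ z ∈ Metric.ball x₀ R ∩ Z, ∃ y ≠ z, ∀ x ∈ Metric.ball x₀ R ∩ Z, dist z y ≤ dist x y := by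
  obtain ⟨y, hyR, hyZ⟩ : ∃ y ∈ Metric.ball x₀ (R / 2), y ∉ Z :=
    Set.not_subset.1 fun h =>
      hnhds (Filter.mem_of_superset (Metric.ball_mem_nhds x₀ (half_pos hR)) h)
  obtain ⟨z, hzZ, hzmin⟩ := hZ.exists_isMinOn ⟨x₀, Metric.mem_closedBall_self hR.le, hx₀⟩
    (continuous_id.dist continuous_const : Continuous fun x => dist x y).continuousOn
  have hzx : dist z y ≤ dist x₀ y := hzmin ⟨Metric.mem_closedBall_self hR.le, hx₀⟩
  have hzR : dist z x₀ < R := by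
    rw [Metric.mem_ball] at hyR
    linarith [dist_triangle z y x₀, dist_comm x₀ y]
  exact ⟨z, ⟨hzR, hzZ.2⟩, y, fun h => hyZ (h ▸ hzZ.2), fun x hx =>
    hzmin ⟨Metric.ball_subset_closedBall hx.1, hx.2⟩⟩

/-- Hopf's strong maximum principle. If `f` is not constant near `x₀`, a ball around some `y`
touches the maximum set at a point `z` of its boundary. The touching point is unique for the smaller
ball `u ≥ 0` with diameter `[y, z]`. -/
theorem eventually_eq_of_secondOrderOp_nonneg {V : Type*} [NormedAddCommGroup V]
    [InnerProductSpace ℝ V] [FiniteDimensional ℝ V] {ι : Type*} [Fintype ι] {b : ι → V}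
    (hb : Submodule.span ℝ (Set.range b) = ⊤) {A : V → Matrix ι ι ℝ} {c : V → ι → ℝ} {f : V → ℝ}
    {x₀ : V} {U : Set V} (hU : U ∈ 𝓝 x₀) (hA : ∀ y ∈ U, ContinuousAt A y)
    (hc : ∀ y ∈ U, ContinuousAt c y) (hpd : ∀ y ∈ U, (A y).PosDef)
    (hf : ∀ y ∈ U, ContDiffAt ℝ 2 f y) (hL : ∀ y ∈ U, 0 ≤ secondOrderOp b (A y) (c y) f y)
    (hmax : ∀ y ∈ U, f y ≤ f x₀) : ∀ᶠ y in 𝓝 x₀, f y = f x₀ := by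
  obtain ⟨R, hR, hball⟩ := Metric.nhds_basis_closedBall.mem_iff.1 hU
  have hfc : ContinuousOn f (Metric.closedBall x₀ R) := fun y hy =>
    (hf y (hball hy)).continuousAt.continuousWithinAt
  have hZ : IsCompact (Metric.closedBall x₀ R ∩ {y | f y = f x₀}) :=
    (isCompact_closedBall x₀ R).of_isClosed_subset
      (hfc.preimage_isClosed_of_isClosed Metric.isClosed_closedBall isClosed_singleton)
      Set.inter_subset_left
  by_contra hne
  obtain ⟨z, ⟨hzR, hfz : f z = f x₀⟩, y, hyz, hclosest⟩ :=
    exists_closest_point_of_notMem_nhds hR hZ rfl hne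
  have hballU : Metric.ball x₀ R ⊆ U := Metric.ball_subset_closedBall.trans hball
  set u : V → ℝ := fun x => inner ℝ (x - z) (y - x) with hu
  have huC : ContDiff ℝ 2 u :=
    (contDiff_id.sub contDiff_const).inner ℝ (contDiff_const.sub contDiff_id)
  have hdu : fderiv ℝ u z (y - z) = ‖y - z‖ ^ 2 := by
    rw [hu, fderiv_inner_apply ℝ (by fun_prop) (by fun_prop), fderiv_sub_const, fderiv_fun_id,
      sub_self, inner_zero_left, zero_add, ContinuousLinearMap.id_apply, real_inner_self_eq_norm_sq]
  have hdub : (fun i => fderiv ℝ u z (b i)) ≠ 0 := fun h => by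
    have hzero : fderiv ℝ u z = 0 := ContinuousLinearMap.coe_injective
      (LinearMap.ext_on_range hb (congrFun h))
    rw [hzero, zero_apply, eq_comm, sq_eq_zero_iff, norm_eq_zero, sub_eq_zero] at hdu
    exact hyz hdu
  obtain ⟨x, hxR, hux, hxz, hfx⟩ := exists_ne_eq_of_secondOrderOp_nonneg (U := Metric.ball x₀ R)
    (Metric.isOpen_ball.mem_nhds hzR) (hA z (hballU hzR)) (hc z (hballU hzR))
    (fun x hx => hpd x (hballU hx)) (fun x hx => hf x (hballU hx)) (fun x hx => hL x (hballU hx))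
    (fun x hx => hfz ▸ hmax x (hballU hx)) huC (by simp [hu]) hdub
  have hcloser : dist z y ≤ dist x y := hclosest x ⟨hxR, hfx.trans hfz⟩
  have hthales : ‖z - y‖ ^ 2 = ‖x - z‖ ^ 2 + 2 * u x + ‖x - y‖ ^ 2 := by
    rw [hu, norm_sub_rev z, norm_sub_rev x y, ← norm_add_sq_real, sub_add_sub_cancel']
  rw [dist_eq_norm, dist_eq_norm] at hcloser
  nlinarith [norm_pos_iff.2 (sub_ne_zero.2 hxz), norm_nonneg (z - y)]

end MaximumPrinciple

section MatrixInverse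

variable {V : Type*} [NormedAddCommGroup V] [NormedSpace ℝ V] {ι : Type*} [Fintype ι]
  [DecidableEq ι] {n : ℕ∞ω} {h : V → Matrix ι ι ℝ} {y : V}

theorem contDiffAt_det (hh : ∀ i j, ContDiffAt ℝ n (fun z => h z i j) y) :
    ContDiffAt ℝ n (fun z => (h z).det) y := by
  simp only [Matrix.det_apply']
  exact ContDiffAt.sum fun σ _ => contDiffAt_const.mul (contDiffAt_prod fun i _ => hh _ _)

theorem contDiffAt_inv_apply (hh : ∀ i j, ContDiffAt ℝ n (fun z => h z i j) y)
    (hdet : (h y).det ≠ 0) (i j : ι) : ContDiffAt ℝ n (fun z => (h z)⁻¹ i j) y := by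
  have hcramer (z : V) : (h z)⁻¹ i j = (h z).det⁻¹ * ((h z).updateRow j (Pi.single i 1)).det := by
    rw [Matrix.inv_def, Matrix.smul_apply, Matrix.adjugate_apply, Ring.inverse_eq_inv', smul_eq_mul]
  simp only [hcramer]
  refine ((contDiffAt_det hh).inv hdet).mul (contDiffAt_det fun k l => ?_)
  by_cases hk : k = j
  · subst hk
    simpa only [Matrix.updateRow_self] using contDiffAt_const
  · simpa only [Matrix.updateRow_ne hk] using hh k l

end MatrixInverse

section Laplacian

variable {V : Type*} [NormedAddCommGroup V] [NormedSpace ℝ V] {ι : Type*} [Fintype ι]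
  [DecidableEq ι]

/-- The component `∑ h^{kl} ∂_l u` of the gradient of `u` with respect to the metric with components
`h` in the linear coordinates given by the basis `b`. -/
noncomputable def gradCoord (b : Module.Basis ι ℝ V) (h : V → Matrix ι ι ℝ) (u : V → ℝ) (k : ι)
    (y : V) : ℝ :=
  ∑ l, (h y)⁻¹ k l * fderiv ℝ u y (b l)

/-- The Laplace–Beltrami operator of the metric with components `h`, as the divergence
`∑ ∂_i X^i + ∑ Γ^i_{il} X^l` of the gradient `X` of `u`. -/
noncomputable def laplacianCoord (b : Module.Basis ι ℝ V) (h : V → Matrix ι ι ℝ) (u : V → ℝ)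
    (y : V) : ℝ :=
  ∑ i, fderiv ℝ (gradCoord b h u i) y (b i)
    + ∑ i, ∑ l, christoffel b h i i l y * gradCoord b h u l y

/-- The coefficient of `∂_m` in the Laplace–Beltrami operator of the metric with components `h`. -/
noncomputable def laplacianDrift (b : Module.Basis ι ℝ V) (h : V → Matrix ι ι ℝ) (y : V) (m : ι) :
    ℝ :=
  ∑ i, fderiv ℝ (fun z => (h z)⁻¹ i m) y (b i)
    + ∑ i, ∑ l, christoffel b h i i l y * (h y)⁻¹ l m

variable {b : Module.Basis ι ℝ V} {h : V → Matrix ι ι ℝ} {u : V → ℝ} {y : V}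

theorem fderiv_gradCoord (hu : ContDiffAt ℝ 2 u y) (hh : ∀ i j, ContDiffAt ℝ 1 (fun z => h z i j) y)
    (hdet : (h y).det ≠ 0) (i : ι) (v : V) :
    fderiv ℝ (gradCoord b h u i) y v
      = ∑ m, ((h y)⁻¹ i m * fderiv ℝ (fderiv ℝ u) y v (b m)
        + fderiv ℝ (fun z => (h z)⁻¹ i m) y v * fderiv ℝ u y (b m)) := by
  have hinv (m : ι) : DifferentiableAt ℝ (fun z => (h z)⁻¹ i m) y :=
    (contDiffAt_inv_apply hh hdet i m).differentiableAt one_ne_zero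
  have hdu (m : ι) : DifferentiableAt ℝ (fun z => fderiv ℝ u z (b m)) y :=
    (differentiableAt_fderiv hu).clm_apply (differentiableAt_const _)
  change fderiv ℝ (fun z => ∑ m, (h z)⁻¹ i m * fderiv ℝ u z (b m)) y v = _
  rw [fderiv_fun_sum fun m _ => (hinv m).fun_mul (hdu m), sum_apply]
  refine Finset.sum_congr rfl fun m _ => ?_
  rw [fderiv_fun_mul (hinv m) (hdu m)]
  simp only [add_apply, smul_apply, smul_eq_mul, fderiv_fderiv_apply hu]
  ring

theorem differentiableAt_gradCoord (hu : ContDiffAt ℝ 2 u y)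
    (hh : ∀ i j, ContDiffAt ℝ 1 (fun z => h z i j) y) (hdet : (h y).det ≠ 0) (i : ι) :
    DifferentiableAt ℝ (gradCoord b h u i) y :=
  DifferentiableAt.fun_sum fun m _ =>
    ((contDiffAt_inv_apply hh hdet i m).differentiableAt one_ne_zero).fun_mul
      ((differentiableAt_fderiv hu).clm_apply (differentiableAt_const _))

theorem laplacianCoord_eq_secondOrderOp (hu : ContDiffAt ℝ 2 u y)
    (hh : ∀ i j, ContDiffAt ℝ 1 (fun z => h z i j) y) (hdet : (h y).det ≠ 0) :
    laplacianCoord b h u y = secondOrderOp b (h y)⁻¹ (laplacianDrift b h y) u y := by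
  have hchristoffel : ∑ i, ∑ l, christoffel b h i i l y * gradCoord b h u l y
      = ∑ m, (∑ i, ∑ l, christoffel b h i i l y * (h y)⁻¹ l m) * fderiv ℝ u y (b m) := by
    simp only [gradCoord, Finset.sum_mul, Finset.mul_sum, mul_assoc]
    rw [Finset.sum_comm_cycle]
  simp only [laplacianCoord, fderiv_gradCoord hu hh hdet, hchristoffel, secondOrderOp,
    laplacianDrift, add_mul, Finset.sum_add_distrib, Finset.sum_mul]
  rw [add_assoc, Finset.sum_comm
    (f := fun i m => fderiv ℝ (fun z => (h z)⁻¹ i m) y (b i) * fderiv ℝ u y (b m))]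

theorem continuousAt_christoffel (hh : ∀ i j, ContDiffAt ℝ 1 (fun z => h z i j) y)
    (hdet : (h y).det ≠ 0) (k i j : ι) : ContinuousAt (christoffel b h k i j) y := by
  have hpartial (i j : ι) (v : V) : ContinuousAt (fun z => fderiv ℝ (fun z => h z i j) z v) y :=
    ((hh i j).fderiv_right (m := 0) (by norm_num)).continuousAt.clm_apply continuousAt_const
  exact continuousAt_const.mul <| tendsto_finsetSum _ fun l _ =>
    (contDiffAt_inv_apply hh hdet k l).continuousAt.mul
      (((hpartial j l _).add (hpartial i l _)).sub (hpartial i j _))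

theorem continuousAt_laplacianDrift (hh : ∀ i j, ContDiffAt ℝ 1 (fun z => h z i j) y)
    (hdet : (h y).det ≠ 0) : ContinuousAt (laplacianDrift b h) y :=
  have hinv (i j : ι) := contDiffAt_inv_apply hh hdet i j
  continuousAt_pi.2 fun m => (tendsto_finsetSum _ fun i _ =>
      ((hinv i m).fderiv_right (m := 0) (by norm_num)).continuousAt.clm_apply
        continuousAt_const).add
    (tendsto_finsetSum _ fun i _ => tendsto_finsetSum _ fun l _ =>
      (continuousAt_christoffel hh hdet i i l).mul (hinv l m).continuousAt)

theorem eventually_eq_of_laplacianCoord_nonneg {V : Type*} [NormedAddCommGroup V]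
    [InnerProductSpace ℝ V] [FiniteDimensional ℝ V] {b : Module.Basis ι ℝ V}
    {h : V → Matrix ι ι ℝ} {u : V → ℝ} {x₀ : V} {U : Set V} (hU : U ∈ 𝓝 x₀)
    (hh : ∀ y ∈ U, ∀ i j, ContDiffAt ℝ 1 (fun z => h z i j) y) (hpd : ∀ y ∈ U, (h y).PosDef)
    (hu : ∀ y ∈ U, ContDiffAt ℝ 2 u y) (hΔ : ∀ y ∈ U, 0 ≤ laplacianCoord b h u y)
    (hmax : ∀ y ∈ U, u y ≤ u x₀) : ∀ᶠ y in 𝓝 x₀, u y = u x₀ := by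
  have hdet (y : V) (hy : y ∈ U) : (h y).det ≠ 0 := (hpd y hy).det_pos.ne'
  refine eventually_eq_of_secondOrderOp_nonneg b.span_eq hU
    (fun y hy => continuousAt_pi.2 fun i => continuousAt_pi.2 fun j =>
      (contDiffAt_inv_apply (hh y hy) (hdet y hy) i j).continuousAt)
    (fun y hy => continuousAt_laplacianDrift (b := b) (hh y hy) (hdet y hy))
    (fun y hy => (hpd y hy).inv) hu (fun y hy => ?_) hmax
  rw [← laplacianCoord_eq_secondOrderOp (hu y hy) (hh y hy) (hdet y hy)]
  exact hΔ y hy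

end Laplacian

section RicciCoord

variable {V : Type*} [NormedAddCommGroup V] [NormedSpace ℝ V] {ι : Type*} [Fintype ι]
  [DecidableEq ι] {b : Module.Basis ι ℝ V} {G G' : V → Matrix ι ι ℝ} {y : V}

theorem christoffel_congr (hG : G =ᶠ[𝓝 y] G') (k i j : ι) :
    christoffel b G k i j =ᶠ[𝓝 y] christoffel b G' k i j := by
  have hentry (i j : ι) : ∀ᶠ z in 𝓝 y,
      fderiv ℝ (fun z => G z i j) z = fderiv ℝ (fun z => G' z i j) z := by
    filter_upwards [hG.eventuallyEq_nhds] with z hz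
    exact (hz.fun_comp fun m => m i j).fderiv_eq
  filter_upwards [hG, hentry i j, Filter.eventually_all.2 (hentry i),
    Filter.eventually_all.2 (hentry j)] with z hz hij hi hj
  simp only [christoffel, hz, hij, hi, hj]

theorem ricciCoord_congr (hG : G =ᶠ[𝓝 y] G') (j k : ι) :
    ricciCoord b G y j k = ricciCoord b G' y j k := by
  simp only [ricciCoord, (christoffel_congr hG _ _ _).fderiv_eq,
    (christoffel_congr hG _ _ _).eq_of_nhds]

end RicciCoord

section StaticMatrix

theorem fderiv_comp_snd {E V W : Type*} [NormedAddCommGroup E] [NormedSpace ℝ E]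
    [NormedAddCommGroup V] [NormedSpace ℝ V] [NormedAddCommGroup W] [NormedSpace ℝ W] (φ : V → W)
    (z v : E × V) : fderiv ℝ (fun z : E × V => φ z.2) z v = fderiv ℝ φ z.2 v.2 := by
  by_cases hφ : DifferentiableAt ℝ φ z.2
  · exact DFunLike.congr_fun (hφ.hasFDerivAt.comp z hasFDerivAt_snd).fderiv v
  · have hcomp : ¬DifferentiableAt ℝ (fun z : E × V => φ z.2) z := fun h =>
      hφ (DifferentiableAt.comp (f := fun y => (z.1, y)) z.2 h
        ((differentiableAt_const z.1).prodMk differentiableAt_id))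
    simp [fderiv_zero_of_not_differentiableAt hφ, fderiv_zero_of_not_differentiableAt hcomp]

section Inverse

variable {V ι : Type*}

/-- The components of the metric `-u² dt² ⊕ h`, with `t` the first coordinate. -/
def staticMatrix (u : V → ℝ) (h : V → Matrix ι ι ℝ) (z : ℝ × V) :
    Matrix (Unit ⊕ ι) (Unit ⊕ ι) ℝ :=
  Matrix.fromBlocks (Matrix.of fun _ _ => -u z.2 ^ 2) 0 0 (h z.2)

theorem inv_staticMatrix [Fintype ι] [DecidableEq ι] {u : V → ℝ} {h : V → Matrix ι ι ℝ} {z : ℝ × V}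
    (hu : u z.2 ≠ 0) (hdet : (h z.2).det ≠ 0) :
    (staticMatrix u h z)⁻¹
      = Matrix.fromBlocks (Matrix.of fun _ _ => -(u z.2 ^ 2)⁻¹) 0 0 (h z.2)⁻¹ := by
  have htime : (Matrix.of fun _ _ => -(u z.2 ^ 2)⁻¹ : Matrix Unit Unit ℝ)
      * (Matrix.of fun _ _ => -u z.2 ^ 2) = 1 := by
    ext i j
    simp [Matrix.mul_apply, hu]
  refine Matrix.inv_eq_left_inv ?_
  rw [staticMatrix, Matrix.fromBlocks_multiply, htime,
    Matrix.nonsing_inv_mul _ (isUnit_iff_ne_zero.2 hdet)]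
  simp

end Inverse

variable {V : Type*} [NormedAddCommGroup V] [NormedSpace ℝ V] {ι : Type*} {u : V → ℝ}
  {h : V → Matrix ι ι ℝ} {z : ℝ × V}

theorem fderiv_staticMatrix_inl_inl (hu : DifferentiableAt ℝ u z.2) (v : ℝ × V) :
    fderiv ℝ (fun z => staticMatrix u h z (.inl ()) (.inl ())) z v
      = -(2 * u z.2 * fderiv ℝ u z.2 v.2) := by
  refine (fderiv_comp_snd (fun y => -u y ^ 2) z v).trans ?_
  rw [fderiv_fun_neg, fderiv_fun_pow 2 hu]
  simp

theorem fderiv_staticMatrix_inl_inr (i : ι) :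
    fderiv ℝ (fun z => staticMatrix u h z (.inl ()) (.inr i)) z = 0 :=
  fderiv_const_apply 0

theorem fderiv_staticMatrix_inr_inl (i : ι) :
    fderiv ℝ (fun z => staticMatrix u h z (.inr i) (.inl ())) z = 0 :=
  fderiv_const_apply 0

theorem fderiv_staticMatrix_inr_inr (i j : ι) (v : ℝ × V) :
    fderiv ℝ (fun z => staticMatrix u h z (.inr i) (.inr j)) z v
      = fderiv ℝ (fun y => h y i j) z.2 v.2 :=
  fderiv_comp_snd (fun y => h y i j) z v

variable [Fintype ι] [DecidableEq ι] {b : Module.Basis ι ℝ V}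

theorem christoffel_staticMatrix_inr_inl_inl (hu : DifferentiableAt ℝ u z.2) (hu₀ : u z.2 ≠ 0)
    (hdet : (h z.2).det ≠ 0) (k : ι) :
    christoffel ((Module.Basis.singleton Unit ℝ).prod b) (staticMatrix u h) (.inr k) (.inl ())
      (.inl ()) z = u z.2 * gradCoord b h u k z.2 := by
  simp only [christoffel, inv_staticMatrix hu₀ hdet, Fintype.sum_sum_type,
    fderiv_staticMatrix_inl_inl hu, fderiv_staticMatrix_inl_inr]
  simp [gradCoord, Finset.mul_sum, mul_left_comm, mul_assoc]

theorem christoffel_staticMatrix_inl_inr_inl (hu : DifferentiableAt ℝ u z.2) (hu₀ : u z.2 ≠ 0)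
    (hdet : (h z.2).det ≠ 0) (i : ι) :
    christoffel ((Module.Basis.singleton Unit ℝ).prod b) (staticMatrix u h) (.inl ()) (.inr i)
      (.inl ()) z = fderiv ℝ u z.2 (b i) / u z.2 := by
  have hcancel : 2⁻¹ * ((u z.2 ^ 2)⁻¹ * (2 * u z.2 * fderiv ℝ u z.2 (b i)))
      = fderiv ℝ u z.2 (b i) / u z.2 := by
    field_simp
  simp only [christoffel, inv_staticMatrix hu₀ hdet, Fintype.sum_sum_type,
    fderiv_staticMatrix_inl_inl hu, fderiv_staticMatrix_inl_inr, fderiv_staticMatrix_inr_inl]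
  simpa using hcancel

theorem christoffel_staticMatrix_inl_inl_inl (hu : DifferentiableAt ℝ u z.2) (hu₀ : u z.2 ≠ 0)
    (hdet : (h z.2).det ≠ 0) :
    christoffel ((Module.Basis.singleton Unit ℝ).prod b) (staticMatrix u h) (.inl ()) (.inl ())
      (.inl ()) z = 0 := by
  simp only [christoffel, inv_staticMatrix hu₀ hdet, Fintype.sum_sum_type,
    fderiv_staticMatrix_inl_inl hu]
  simp

theorem christoffel_staticMatrix_inr_inr_inl (hu₀ : u z.2 ≠ 0) (hdet : (h z.2).det ≠ 0)
    (k i : ι) :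
    christoffel ((Module.Basis.singleton Unit ℝ).prod b) (staticMatrix u h) (.inr k) (.inr i)
      (.inl ()) z = 0 := by
  simp only [christoffel, inv_staticMatrix hu₀ hdet, Fintype.sum_sum_type,
    fderiv_staticMatrix_inl_inr, fderiv_staticMatrix_inr_inl, fderiv_staticMatrix_inr_inr]
  simp

theorem christoffel_staticMatrix_inr_inl_inr (hu₀ : u z.2 ≠ 0) (hdet : (h z.2).det ≠ 0)
    (k i : ι) :
    christoffel ((Module.Basis.singleton Unit ℝ).prod b) (staticMatrix u h) (.inr k) (.inl ())
      (.inr i) z = 0 := by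
  simp only [christoffel, inv_staticMatrix hu₀ hdet, Fintype.sum_sum_type,
    fderiv_staticMatrix_inl_inr, fderiv_staticMatrix_inr_inl, fderiv_staticMatrix_inr_inr]
  simp

theorem christoffel_staticMatrix_inr_inr_inr (hu₀ : u z.2 ≠ 0) (hdet : (h z.2).det ≠ 0)
    (k i j : ι) :
    christoffel ((Module.Basis.singleton Unit ℝ).prod b) (staticMatrix u h) (.inr k) (.inr i)
      (.inr j) z = christoffel b h k i j z.2 := by
  simp only [christoffel, inv_staticMatrix hu₀ hdet, Fintype.sum_sum_type,
    fderiv_staticMatrix_inr_inr]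
  simp

theorem fderiv_christoffel_staticMatrix_inr_inl_inl (hu : ContDiffAt ℝ 2 u z.2) (hu₀ : u z.2 ≠ 0)
    (hh : ∀ i j, ContDiffAt ℝ 1 (fun y => h y i j) z.2) (hdet : (h z.2).det ≠ 0) (k : ι)
    (v : ℝ × V) :
    fderiv ℝ (christoffel ((Module.Basis.singleton Unit ℝ).prod b) (staticMatrix u h) (.inr k)
      (.inl ()) (.inl ())) z v
      = u z.2 * fderiv ℝ (gradCoord b h u k) z.2 v.2
        + gradCoord b h u k z.2 * fderiv ℝ u z.2 v.2 := by
  have heq : christoffel ((Module.Basis.singleton Unit ℝ).prod b) (staticMatrix u h) (.inr k)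
      (.inl ()) (.inl ()) =ᶠ[𝓝 z] fun z' => u z'.2 * gradCoord b h u k z'.2 := by
    filter_upwards [continuousAt_snd.eventually (eventually_differentiableAt hu),
      continuousAt_snd.eventually (hu.continuousAt.eventually_ne hu₀),
      continuousAt_snd.eventually ((contDiffAt_det hh).continuousAt.eventually_ne hdet)]
      with z' hu' hu₀' hdet' using christoffel_staticMatrix_inr_inl_inl hu' hu₀' hdet' k
  rw [heq.fderiv_eq, fderiv_comp_snd (fun y => u y * gradCoord b h u k y),
    fderiv_fun_mul (hu.differentiableAt two_ne_zero) (differentiableAt_gradCoord hu hh hdet k)]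
  rfl

theorem fderiv_christoffel_staticMatrix_inr_inr_inl (hu : ContinuousAt u z.2) (hu₀ : u z.2 ≠ 0)
    (hh : ∀ i j, ContinuousAt (fun y => h y i j) z.2) (hdet : (h z.2).det ≠ 0) (k i : ι) :
    fderiv ℝ (christoffel ((Module.Basis.singleton Unit ℝ).prod b) (staticMatrix u h) (.inr k)
      (.inr i) (.inl ())) z = 0 := by
  have hdetc : ContinuousAt (fun y => (h y).det) z.2 :=
    (continuous_id.matrix_det.continuousAt (x := h z.2)).comp
      (continuousAt_pi.2 fun i => continuousAt_pi.2 (hh i))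
  have heq : christoffel ((Module.Basis.singleton Unit ℝ).prod b) (staticMatrix u h) (.inr k)
      (.inr i) (.inl ()) =ᶠ[𝓝 z] fun _ => 0 := by
    filter_upwards [continuousAt_snd.eventually (hu.eventually_ne hu₀),
      continuousAt_snd.eventually (hdetc.eventually_ne hdet)]
      with z' hu₀' hdet' using christoffel_staticMatrix_inr_inr_inl hu₀' hdet' k i
  rw [heq.fderiv_eq, fderiv_fun_const, Pi.zero_apply]

theorem ricciCoord_staticMatrix_inl_inl (hu : ContDiffAt ℝ 2 u z.2) (hu₀ : u z.2 ≠ 0)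
    (hh : ∀ i j, ContDiffAt ℝ 1 (fun y => h y i j) z.2) (hdet : (h z.2).det ≠ 0) :
    ricciCoord ((Module.Basis.singleton Unit ℝ).prod b) (staticMatrix u h) z (.inl ()) (.inl ())
      = u z.2 * laplacianCoord b h u z.2 := by
  have hud := hu.differentiableAt two_ne_zero
  have hcancel (i : ι) : u z.2 * gradCoord b h u i z.2 * (fderiv ℝ u z.2 (b i) / u z.2)
      = gradCoord b h u i z.2 * fderiv ℝ u z.2 (b i) := by
    field_simp
  simp only [ricciCoord, laplacianCoord, Fintype.sum_sum_type, hcancel,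
    fderiv_christoffel_staticMatrix_inr_inl_inl hu hu₀ hh hdet,
    fderiv_christoffel_staticMatrix_inr_inr_inl hu.continuousAt hu₀
      (fun i j => (hh i j).continuousAt) hdet,
    christoffel_staticMatrix_inr_inl_inl hud hu₀ hdet,
    christoffel_staticMatrix_inl_inl_inl hud hu₀ hdet,
    christoffel_staticMatrix_inl_inr_inl hud hu₀ hdet,
    christoffel_staticMatrix_inr_inr_inl hu₀ hdet, christoffel_staticMatrix_inr_inl_inr hu₀ hdet,
    christoffel_staticMatrix_inr_inr_inr hu₀ hdet]
  simp [Finset.sum_add_distrib, mul_add, Finset.mul_sum, mul_left_comm (u z.2)]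

end StaticMatrix

section Gram

theorem posDef_gram_of_linearIndependent {ι W : Type*} [AddCommGroup W] [Module ℝ W]
    [TopologicalSpace W] {β : W →L[ℝ] W →L[ℝ] ℝ} (hsymm : ∀ v w, β v w = β w v)
    (hpos : ∀ v, v ≠ 0 → 0 < β v v) {w : ι → W} (hw : LinearIndependent ℝ w) :
    (Matrix.of fun i j => β (w i) (w j)).PosDef := by
  refine ⟨Matrix.ext fun i j => hsymm _ _, fun ξ hξ => ?_⟩
  have hv : ξ.sum (fun i a => a • w i) ≠ 0 := fun h => hξ (linearIndependent_iff.1 hw ξ h)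
  refine (hpos _ hv).trans_eq ?_
  simp only [Finsupp.sum, map_sum, map_smul, sum_apply, smul_apply, smul_eq_mul, Finset.mul_sum,
    Matrix.of_apply, star_trivial]
  rw [Finset.sum_comm]
  exact Finset.sum_congr rfl fun i _ => Finset.sum_congr rfl fun j _ => by ring

end Gram

section Chart

variable {E : Type*} [NormedAddCommGroup E] [NormedSpace ℝ E] {H : Type*} [TopologicalSpace H]
  {I : ModelWithCorners ℝ E H} [I.Boundaryless] {M : Type*} [TopologicalSpace M] [ChartedSpace H M]

theorem mdifferentiableAt_extChartAt_symm [IsManifold I 1 M] {x₀ : M} {y : E}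
    (hy : y ∈ (extChartAt I x₀).target) :
    MDifferentiableAt 𝓘(ℝ, E) I (extChartAt I x₀).symm y := by
  have h := mdifferentiableWithinAt_extChartAt_symm hy
  rwa [I.range_eq_univ, mdifferentiableWithinAt_univ] at h

theorem mfderiv_extChartAt_mfderiv_symm [IsManifold I 1 M] {x₀ : M} {y : E}
    (hy : y ∈ (extChartAt I x₀).target) (v : E) :
    mfderiv I 𝓘(ℝ, E) (extChartAt I x₀) ((extChartAt I x₀).symm y)
      (mfderiv 𝓘(ℝ, E) I (extChartAt I x₀).symm y v) = v := by
  have h := mfderiv_extChartAt_comp_mfderivWithin_extChartAt_symm hy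
  rw [I.range_eq_univ, mfderivWithin_univ] at h
  exact DFunLike.congr_fun h v

theorem contDiffAt_comp_extChartAt_symm {n : ℕ∞ω} [IsManifold I n M] {W : Type*}
    [NormedAddCommGroup W] [NormedSpace ℝ W] {f : M → W} (hf : ContMDiff I 𝓘(ℝ, W) n f) {x₀ : M}
    {y : E} (hy : y ∈ (extChartAt I x₀).target) :
    ContDiffAt ℝ n (f ∘ (extChartAt I x₀).symm) y :=
  (contMDiffOn_iff_contDiffOn.1
    (hf.comp_contMDiffOn (contMDiffOn_extChartAt_symm x₀))).contDiffAt
    ((isOpen_extChartAt_target x₀).mem_nhds hy)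

variable {ι : Type*} {b : Module.Basis ι ℝ E}

theorem ricci_mfderiv_extChartAt_symm [Fintype ι] [DecidableEq ι] [IsManifold I 1 M]
    (g : ∀ p : M, TangentSpace I p →L[ℝ] TangentSpace I p →L[ℝ] ℝ) {x₀ : M} {y : E}
    (hy : y ∈ (extChartAt I x₀).target) (j k : ι) :
    ricci b I g (chartAt H x₀) ((extChartAt I x₀).symm y)
      (mfderiv 𝓘(ℝ, E) I (extChartAt I x₀).symm y (b j))
      (mfderiv 𝓘(ℝ, E) I (extChartAt I x₀).symm y (b k))
      = ricciCoord b (metricInChart b I g (chartAt H x₀)) y j k := by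
  have hcoord : (chartAt H x₀).extend I ((extChartAt I x₀).symm y) = y :=
    (extChartAt I x₀).right_inv hy
  have hrepr (i l : ι) : b.repr (mfderiv I 𝓘(ℝ, E) ((chartAt H x₀).extend I)
      ((extChartAt I x₀).symm y) (mfderiv 𝓘(ℝ, E) I (extChartAt I x₀).symm y (b i))) l
        = if i = l then 1 else 0 :=
    (congrArg (fun w => b.repr w l) (mfderiv_extChartAt_mfderiv_symm hy (b i))).trans
      (b.repr_self_apply i l)
  simp only [ricci, hcoord, hrepr, mul_ite, mul_one, mul_zero, Finset.sum_ite_eq,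
    Finset.mem_univ, if_true]

variable [IsManifold I ∞ M]
  (g : Bundle.ContMDiffRiemannianMetric I ∞ E (fun x : M => TangentSpace I x)) {x₀ : M}

theorem posDef_metricInChart {y : E} (hy : y ∈ (extChartAt I x₀).target) :
    (metricInChart b I g.inner (chartAt H x₀) y).PosDef := by
  let D : E →L[ℝ] TangentSpace I ((extChartAt I x₀).symm y) :=
    mfderiv 𝓘(ℝ, E) I (extChartAt I x₀).symm y
  have hD : Function.Injective D :=
    Function.LeftInverse.injective (mfderiv_extChartAt_mfderiv_symm hy)
  exact posDef_gram_of_linearIndependent (g.symm _) (g.pos _)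
    (b.linearIndependent.map' D.toLinearMap (LinearMap.ker_eq_bot.2 hD))

theorem contMDiffOn_mfderiv_extChartAt_symm (x₀ : M) (v : E) :
    ContMDiffOn 𝓘(ℝ, E) I.tangent ∞
      (fun y => (⟨(extChartAt I x₀).symm y, mfderiv 𝓘(ℝ, E) I (extChartAt I x₀).symm y v⟩ :
        TangentBundle I M)) (extChartAt I x₀).target := by
  have hU := isOpen_extChartAt_target (I := I) x₀
  have htangent := (contMDiffOn_extChartAt_symm (n := ∞) x₀).contMDiffOn_tangentMapWithin
    (m := ∞) (by simp) hU.uniqueMDiffOn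
  have hconst : ContMDiffOn 𝓘(ℝ, E) 𝓘(ℝ, E).tangent ∞
      (fun y => (⟨y, v⟩ : TangentBundle 𝓘(ℝ, E) E)) (extChartAt I x₀).target :=
    contMDiffOn_vectorSpace_iff_contDiffOn.mpr contDiffOn_const
  refine (htangent.comp hconst fun y hy => hy).congr fun y hy => ?_
  simp only [Function.comp_apply, tangentMapWithin, mfderivWithin_of_isOpen hU hy]

theorem contDiffOn_metricInChart (x₀ : M) (i j : ι) :
    ContDiffOn ℝ ∞ (fun y => metricInChart b I g.inner (chartAt H x₀) y i j)
      (extChartAt I x₀).target := by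
  rw [← contMDiffOn_iff_contDiffOn]
  intro y hy
  have h := ContMDiffWithinAt.clm_bundle_apply₂ (F₁ := E) (F₂ := E)
    (E₁ := fun x : M => TangentSpace I x) (E₂ := fun x : M => TangentSpace I x) (F₃ := ℝ)
    (E₃ := Bundle.Trivial M ℝ)
    (g.contMDiff.contMDiffAt.comp_contMDiffWithinAt y (contMDiffOn_extChartAt_symm x₀ y hy))
    (contMDiffOn_mfderiv_extChartAt_symm x₀ (b i) y hy)
    (contMDiffOn_mfderiv_extChartAt_symm x₀ (b j) y hy)
  rw [Bundle.contMDiffWithinAt_totalSpace] at h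
  exact h.2

end Chart

section ProductChart

variable {E : Type*} [NormedAddCommGroup E] [NormedSpace ℝ E] {H : Type*} [TopologicalSpace H]
  {I : ModelWithCorners ℝ E H} [I.Boundaryless] {M : Type*} [TopologicalSpace M] [ChartedSpace H M]
  [IsManifold I 1 M] {E' : Type*} [NormedAddCommGroup E'] [NormedSpace ℝ E']

theorem mfderiv_snd_mfderiv_extChartAt_symm {H' : Type*} [TopologicalSpace H']
    {I' : ModelWithCorners ℝ E' H'} [I'.Boundaryless] {M' : Type*} [TopologicalSpace M']
    [ChartedSpace H' M'] [IsManifold I' 1 M'] {p : M' × M} {z : E' × E}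
    (hz : z ∈ (extChartAt (I'.prod I) p).target) (v : E' × E) :
    mfderiv (I'.prod I) I Prod.snd ((extChartAt (I'.prod I) p).symm z)
      (mfderiv 𝓘(ℝ, E' × E) (I'.prod I) (extChartAt (I'.prod I) p).symm z v)
      = mfderiv 𝓘(ℝ, E) I (extChartAt I p.2).symm z.2 v.2 := by
  have hz₂ : z.2 ∈ (extChartAt I p.2).target := by
    rw [extChartAt_prod] at hz
    exact hz.2
  have hcomm : Prod.snd ∘ (extChartAt (I'.prod I) p).symm
      = (extChartAt I p.2).symm ∘ Prod.snd := by
    rw [extChartAt_prod]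
    rfl
  have hleft := mfderiv_comp z mdifferentiableAt_snd (mdifferentiableAt_extChartAt_symm hz)
  have hright := mfderiv_comp (I := 𝓘(ℝ, E' × E)) (I' := 𝓘(ℝ, E)) z
    (mdifferentiableAt_extChartAt_symm hz₂) (f := Prod.snd)
    (DifferentiableAt.mdifferentiableAt differentiableAt_snd)
  rw [hcomm, hright, mfderiv_eq_fderiv, fderiv_snd] at hleft
  exact (DFunLike.congr_fun hleft v).symm

theorem mfderiv_fst_val_mfderiv_extChartAt_symm {U : TopologicalSpace.Opens E'} {p : U × M}
    {z : E' × E} (hz : z ∈ (extChartAt (𝓘(ℝ, E').prod I) p).target) (v : E' × E) :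
    mfderiv (𝓘(ℝ, E').prod I) 𝓘(ℝ, E') (fun q : U × M => (q.1 : E'))
      ((extChartAt (𝓘(ℝ, E').prod I) p).symm z)
      (mfderiv 𝓘(ℝ, E' × E) (𝓘(ℝ, E').prod I) (extChartAt (𝓘(ℝ, E').prod I) p).symm z v)
      = v.1 := by
  have hval : MDifferentiable (𝓘(ℝ, E').prod I) 𝓘(ℝ, E') (fun q : U × M => (q.1 : E')) :=
    ((contMDiff_subtype_val (I := 𝓘(ℝ, E')) (n := 1)).comp contMDiff_fst).mdifferentiable
      one_ne_zero
  have heq : (fun q : U × M => (q.1 : E')) ∘ (extChartAt (𝓘(ℝ, E').prod I) p).symm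
      =ᶠ[𝓝 z] Prod.fst := by
    filter_upwards [(isOpen_extChartAt_target p).mem_nhds hz] with w hw
    rw [extChartAt_prod] at hw ⊢
    exact (extChartAt 𝓘(ℝ, E') p.1).right_inv hw.1
  have hcomp := mfderiv_comp z (hval _) (mdifferentiableAt_extChartAt_symm hz)
  rw [heq.mfderiv_eq, mfderiv_eq_fderiv, fderiv_fst] at hcomp
  exact (DFunLike.congr_fun hcomp v).symm

end ProductChart

section EnergyConditions

variable {E : Type*} [NormedAddCommGroup E] [NormedSpace ℝ E] {ι : Type*} [Fintype ι]
  [DecidableEq ι] {b : Module.Basis ι ℝ E} {H : Type*} [TopologicalSpace H]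
  {I : ModelWithCorners ℝ E H} {M : Type*} [TopologicalSpace M] [ChartedSpace H M]
  {g : ∀ p : M, TangentSpace I p →L[ℝ] TangentSpace I p →L[ℝ] ℝ}

theorem continuous_ricci (e : OpenPartialHomeomorph M H) (p : M) :
    Continuous fun v : TangentSpace I p => ricci b I g e p v v := by
  have : FiniteDimensional ℝ E := b.finiteDimensional_of_finite
  have hcoord (k : ι) : Continuous fun v : TangentSpace I p =>
      b.repr (mfderiv I 𝓘(ℝ, E) (e.extend I) p v) k :=
    (b.coord k).continuous_of_finiteDimensional.comp (mfderiv I 𝓘(ℝ, E) (e.extend I) p).continuous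
  exact continuous_finsetSum _ fun j _ => continuous_finsetSum _ fun k _ =>
    (continuous_const.mul (hcoord j)).mul (hcoord k)

theorem IsTimelike.ne_zero {p : M} {v : TangentSpace I p} (hv : IsTimelike I g p v) : v ≠ 0 := by
  rintro rfl
  simp [IsTimelike] at hv

theorem IsTimelike.isCausal {p : M} {v : TangentSpace I p} (hv : IsTimelike I g p v) :
    IsCausal I g p v :=
  ⟨hv.ne_zero, hv.le⟩

theorem IsTimelike.neg {p : M} {v : TangentSpace I p} (hv : IsTimelike I g p v) :
    IsTimelike I g p (-v) := by
  simpa [IsTimelike] using hv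

theorem isTimelike_add_smul {p : M} (hsymm : ∀ v w, g p v w = g p w v) {v w : TangentSpace I p}
    (hv : g p v v ≤ 0) (hw : IsTimelike I g p w) (hvw : g p v w ≤ 0) {ε : ℝ} (hε : 0 < ε) :
    IsTimelike I g p (v + ε • w) := by
  have hexpand : g p (v + ε • w) (v + ε • w)
      = g p v v + 2 * ε * g p v w + ε ^ 2 * g p w w := by
    simp only [map_add, map_smul, add_apply, smul_apply, smul_eq_mul, hsymm w v]
    ring
  rw [IsTimelike] at hw ⊢
  rw [hexpand]
  linarith [mul_nonpos_of_nonneg_of_nonpos (mul_pos two_pos hε).le hvw,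
    mul_neg_of_pos_of_neg (pow_pos hε 2) hw]

theorem strongEnergyCondition_iff_timelikeConvergenceCondition
    (hsymm : ∀ p v w, g p v w = g p w v) (htimelike : ∀ p, ∃ w, IsTimelike I g p w) :
    StrongEnergyCondition b I g ↔ TimelikeConvergenceCondition b I g := by
  refine ⟨fun h p v hv => h p v hv.isCausal, fun h p v hv e he hp => ?_⟩
  obtain ⟨w, hw, hvw⟩ : ∃ w, IsTimelike I g p w ∧ g p v w ≤ 0 := by
    obtain ⟨w, hw⟩ := htimelike p
    rcases le_total (g p v w) 0 with hvw | hvw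
    · exact ⟨w, hw, hvw⟩
    · exact ⟨-w, hw.neg, by simpa using hvw⟩
  have hlimit : Filter.Tendsto (fun ε : ℝ => ricci b I g e p (v + ε • w) (v + ε • w)) (𝓝[>] 0)
      (𝓝 (ricci b I g e p v v)) := by
    have hcont := (continuous_ricci (b := b) (g := g) e p).comp
      (show Continuous fun ε : ℝ => v + ε • w by fun_prop)
    simpa [Function.comp_def] using (hcont.tendsto 0).mono_left nhdsWithin_le_nhds
  refine ge_of_tendsto hlimit ?_
  filter_upwards [self_mem_nhdsWithin] with ε hε
  exact h p _ (isTimelike_add_smul (hsymm p) hv.2 hw hvw hε) e he hp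

end EnergyConditions

section StaticMetric

variable {s : ℕ} {F : Type*} [TopologicalSpace F] [ChartedSpace (EuclideanSpace ℝ (Fin s)) F]
  [IsManifold (𝓡 s) ∞ F] {t₁ t₂ : EReal}
  {gF : Bundle.ContMDiffRiemannianMetric (𝓡 s) ∞ (EuclideanSpace ℝ (Fin s))
    (fun x : F => TangentSpace (𝓡 s) x)} {f : F → ℝ} {p : openInterval t₁ t₂ × F}

/-- The differential `dt` of the time function. -/
noncomputable def timeForm (p : openInterval t₁ t₂ × F) :
    TangentSpace (𝓘(ℝ, ℝ).prod (𝓡 s)) p →L[ℝ] ℝ :=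
  mfderiv (𝓘(ℝ, ℝ).prod (𝓡 s)) 𝓘(ℝ, ℝ) (fun q : openInterval t₁ t₂ × F => (q.1 : ℝ)) p

/-- The differential `dσ` of the projection `σ` to the fibre `F`. -/
noncomputable def fibreMap (p : openInterval t₁ t₂ × F) :
    TangentSpace (𝓘(ℝ, ℝ).prod (𝓡 s)) p →L[ℝ] TangentSpace (𝓡 s) p.2 :=
  mfderiv (𝓘(ℝ, ℝ).prod (𝓡 s)) (𝓡 s) Prod.snd p

theorem staticMetric_apply (v w : TangentSpace (𝓘(ℝ, ℝ).prod (𝓡 s)) p) :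
    staticMetric t₁ t₂ f gF p v w
      = gF.inner p.2 (fibreMap p v) (fibreMap p w) - f p.2 ^ 2 * (timeForm p v * timeForm p w) :=
  rfl

theorem staticMetric_symm (v w : TangentSpace (𝓘(ℝ, ℝ).prod (𝓡 s)) p) :
    staticMetric t₁ t₂ f gF p v w = staticMetric t₁ t₂ f gF p w v := by
  rw [staticMetric_apply, staticMetric_apply, gF.symm, mul_comm (timeForm p v)]

theorem staticMetric_mfderiv_extChartAt_symm {z : ℝ × EuclideanSpace ℝ (Fin s)}
    (hz : z ∈ (extChartAt (𝓘(ℝ, ℝ).prod (𝓡 s)) p).target)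
    (v w : ℝ × EuclideanSpace ℝ (Fin s)) :
    staticMetric t₁ t₂ f gF ((extChartAt (𝓘(ℝ, ℝ).prod (𝓡 s)) p).symm z)
      (mfderiv 𝓘(ℝ, ℝ × EuclideanSpace ℝ (Fin s)) (𝓘(ℝ, ℝ).prod (𝓡 s))
        (extChartAt (𝓘(ℝ, ℝ).prod (𝓡 s)) p).symm z v)
      (mfderiv 𝓘(ℝ, ℝ × EuclideanSpace ℝ (Fin s)) (𝓘(ℝ, ℝ).prod (𝓡 s))
        (extChartAt (𝓘(ℝ, ℝ).prod (𝓡 s)) p).symm z w)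
    = gF.inner ((extChartAt (𝓡 s) p.2).symm z.2)
        (mfderiv 𝓘(ℝ, EuclideanSpace ℝ (Fin s)) (𝓡 s) (extChartAt (𝓡 s) p.2).symm z.2 v.2)
        (mfderiv 𝓘(ℝ, EuclideanSpace ℝ (Fin s)) (𝓡 s) (extChartAt (𝓡 s) p.2).symm z.2 w.2)
      - f ((extChartAt (𝓡 s) p.2).symm z.2) ^ 2 * (v.1 * w.1) := by
  have hsnd : ((extChartAt (𝓘(ℝ, ℝ).prod (𝓡 s)) p).symm z).2 = (extChartAt (𝓡 s) p.2).symm z.2 := by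
    rw [extChartAt_prod]
    rfl
  have htime (v : ℝ × EuclideanSpace ℝ (Fin s)) : timeForm _
      (mfderiv 𝓘(ℝ, ℝ × EuclideanSpace ℝ (Fin s)) (𝓘(ℝ, ℝ).prod (𝓡 s))
        (extChartAt (𝓘(ℝ, ℝ).prod (𝓡 s)) p).symm z v) = v.1 :=
    mfderiv_fst_val_mfderiv_extChartAt_symm hz v
  have hfibre (v : ℝ × EuclideanSpace ℝ (Fin s)) : fibreMap _
      (mfderiv 𝓘(ℝ, ℝ × EuclideanSpace ℝ (Fin s)) (𝓘(ℝ, ℝ).prod (𝓡 s))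
        (extChartAt (𝓘(ℝ, ℝ).prod (𝓡 s)) p).symm z v)
      = mfderiv 𝓘(ℝ, EuclideanSpace ℝ (Fin s)) (𝓡 s) (extChartAt (𝓡 s) p.2).symm z.2 v.2 :=
    mfderiv_snd_mfderiv_extChartAt_symm hz v
  rw [staticMetric_apply, htime, htime, hfibre, hfibre, hsnd]

theorem metricInChart_staticMetric {z : ℝ × EuclideanSpace ℝ (Fin s)}
    (hz : z ∈ (extChartAt (𝓘(ℝ, ℝ).prod (𝓡 s)) p).target) :
    metricInChart (staticBasis s) (𝓘(ℝ, ℝ).prod (𝓡 s)) (staticMetric t₁ t₂ f gF) (chartAt _ p) z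
      = staticMatrix (f ∘ (extChartAt (𝓡 s) p.2).symm)
          (metricInChart (EuclideanSpace.basisFun (Fin s) ℝ).toBasis (𝓡 s) gF.inner
            (chartAt _ p.2)) z := by
  obtain ⟨β, hβ⟩ : ∃ β : EuclideanSpace ℝ (Fin s) →L[ℝ] EuclideanSpace ℝ (Fin s) →L[ℝ] ℝ,
      ∀ v w : EuclideanSpace ℝ (Fin s), β v w = gF.inner ((extChartAt (𝓡 s) p.2).symm z.2)
        (mfderiv 𝓘(ℝ, EuclideanSpace ℝ (Fin s)) (𝓡 s) (extChartAt (𝓡 s) p.2).symm z.2 v)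
        (mfderiv 𝓘(ℝ, EuclideanSpace ℝ (Fin s)) (𝓡 s) (extChartAt (𝓡 s) p.2).symm z.2 w) :=
    let D : EuclideanSpace ℝ (Fin s) →L[ℝ] TangentSpace (𝓡 s)
        ((extChartAt (𝓡 s) p.2).symm z.2) :=
      mfderiv 𝓘(ℝ, EuclideanSpace ℝ (Fin s)) (𝓡 s) (extChartAt (𝓡 s) p.2).symm z.2
    ⟨(ContinuousLinearMap.precomp ℝ D) ∘L (gF.inner _) ∘L D, fun _ _ => rfl⟩
  have hfibre (i j : Fin s) : metricInChart (EuclideanSpace.basisFun (Fin s) ℝ).toBasis (𝓡 s)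
      gF.inner (chartAt _ p.2) z.2 i j
      = β ((EuclideanSpace.basisFun (Fin s) ℝ).toBasis i)
        ((EuclideanSpace.basisFun (Fin s) ℝ).toBasis j) := (hβ _ _).symm
  ext i j
  refine (staticMetric_mfderiv_extChartAt_symm hz (staticBasis s i) (staticBasis s j)).trans ?_
  refine (congrArg (· - _) (hβ _ _).symm).trans ?_
  rcases i with i | i <;> rcases j with j | j <;> simp [staticBasis, staticMatrix, hfibre]

theorem isTimelike_mfderiv_extChartAt_symm (hf : ∀ x, f x ≠ 0)
    {z : ℝ × EuclideanSpace ℝ (Fin s)} (hz : z ∈ (extChartAt (𝓘(ℝ, ℝ).prod (𝓡 s)) p).target) :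
    IsTimelike (𝓘(ℝ, ℝ).prod (𝓡 s)) (staticMetric t₁ t₂ f gF)
      ((extChartAt (𝓘(ℝ, ℝ).prod (𝓡 s)) p).symm z)
      (mfderiv 𝓘(ℝ, ℝ × EuclideanSpace ℝ (Fin s)) (𝓘(ℝ, ℝ).prod (𝓡 s))
        (extChartAt (𝓘(ℝ, ℝ).prod (𝓡 s)) p).symm z (staticBasis s (.inl ()))) := by
  have hentry := congrFun₂ (metricInChart_staticMetric (gF := gF) (f := f) hz) (.inl ()) (.inl ())
  exact hentry.trans_lt (neg_neg_of_pos (sq_pos_of_ne_zero (hf _)))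

theorem exists_isTimelike_staticMetric (hf : ∀ x, f x ≠ 0) (p : openInterval t₁ t₂ × F) :
    ∃ v, IsTimelike (𝓘(ℝ, ℝ).prod (𝓡 s)) (staticMetric t₁ t₂ f gF) p v := by
  have hp := mem_extChartAt_target (I := 𝓘(ℝ, ℝ).prod (𝓡 s)) p
  have h : ∃ v, IsTimelike (𝓘(ℝ, ℝ).prod (𝓡 s)) (staticMetric t₁ t₂ f gF) _ v :=
    ⟨_, isTimelike_mfderiv_extChartAt_symm (gF := gF) hf hp⟩
  rwa [extChartAt_to_inv] at h

theorem ricci_staticMetric_mfderiv_inl (hf : ContMDiff (𝓡 s) 𝓘(ℝ, ℝ) 2 f) (hf₀ : ∀ x, f x ≠ 0)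
    {z : ℝ × EuclideanSpace ℝ (Fin s)} (hz : z ∈ (extChartAt (𝓘(ℝ, ℝ).prod (𝓡 s)) p).target) :
    ricci (staticBasis s) (𝓘(ℝ, ℝ).prod (𝓡 s)) (staticMetric t₁ t₂ f gF) (chartAt _ p)
      ((extChartAt (𝓘(ℝ, ℝ).prod (𝓡 s)) p).symm z)
      (mfderiv 𝓘(ℝ, ℝ × EuclideanSpace ℝ (Fin s)) (𝓘(ℝ, ℝ).prod (𝓡 s))
        (extChartAt (𝓘(ℝ, ℝ).prod (𝓡 s)) p).symm z (staticBasis s (.inl ())))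
      (mfderiv 𝓘(ℝ, ℝ × EuclideanSpace ℝ (Fin s)) (𝓘(ℝ, ℝ).prod (𝓡 s))
        (extChartAt (𝓘(ℝ, ℝ).prod (𝓡 s)) p).symm z (staticBasis s (.inl ())))
      = f ((extChartAt (𝓡 s) p.2).symm z.2)
        * laplacianCoord (EuclideanSpace.basisFun (Fin s) ℝ).toBasis
          (metricInChart (EuclideanSpace.basisFun (Fin s) ℝ).toBasis (𝓡 s) gF.inner
            (chartAt _ p.2)) (f ∘ (extChartAt (𝓡 s) p.2).symm) z.2 := by
  have hz₂ : z.2 ∈ (extChartAt (𝓡 s) p.2).target := by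
    rw [extChartAt_prod] at hz
    exact hz.2
  have hmetric : metricInChart (staticBasis s) (𝓘(ℝ, ℝ).prod (𝓡 s)) (staticMetric t₁ t₂ f gF)
      (chartAt _ p) =ᶠ[𝓝 z] staticMatrix (f ∘ (extChartAt (𝓡 s) p.2).symm)
        (metricInChart (EuclideanSpace.basisFun (Fin s) ℝ).toBasis (𝓡 s) gF.inner
          (chartAt _ p.2)) := by
    filter_upwards [(isOpen_extChartAt_target p).mem_nhds hz] with w hw
      using metricInChart_staticMetric hw
  rw [ricci_mfderiv_extChartAt_symm _ hz, ricciCoord_congr hmetric]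
  exact ricciCoord_staticMatrix_inl_inl (contDiffAt_comp_extChartAt_symm hf hz₂) (hf₀ _)
    (fun i j => ((contDiffOn_metricInChart gF p.2 i j).contDiffAt
      ((isOpen_extChartAt_target p.2).mem_nhds hz₂)).of_le (by simp))
    (posDef_metricInChart gF hz₂).det_pos.ne'

theorem TimelikeConvergenceCondition.laplacianCoord_nonneg
    (h : TimelikeConvergenceCondition (staticBasis s) (𝓘(ℝ, ℝ).prod (𝓡 s))
      (staticMetric t₁ t₂ f gF)) (hf : ContMDiff (𝓡 s) 𝓘(ℝ, ℝ) 2 f) (hpos : ∀ x, 0 < f x)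
    (ht : t₁ < t₂) {x₀ : F} {y : EuclideanSpace ℝ (Fin s)} (hy : y ∈ (extChartAt (𝓡 s) x₀).target) :
    0 ≤ laplacianCoord (EuclideanSpace.basisFun (Fin s) ℝ).toBasis
      (metricInChart (EuclideanSpace.basisFun (Fin s) ℝ).toBasis (𝓡 s) gF.inner (chartAt _ x₀))
      (f ∘ (extChartAt (𝓡 s) x₀).symm) y := by
  obtain ⟨t, ht₁, ht₂⟩ := EReal.lt_iff_exists_real_btwn.1 ht
  let p : openInterval t₁ t₂ × F := (⟨t, ht₁, ht₂⟩, x₀)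
  let z : ℝ × EuclideanSpace ℝ (Fin s) := (extChartAt 𝓘(ℝ, ℝ) p.1 p.1, y)
  have hz : z ∈ (extChartAt (𝓘(ℝ, ℝ).prod (𝓡 s)) p).target := by
    rw [extChartAt_prod]
    exact ⟨mem_extChartAt_target _, hy⟩
  have hsource : (extChartAt (𝓘(ℝ, ℝ).prod (𝓡 s)) p).symm z
      ∈ (chartAt (ModelProd ℝ (EuclideanSpace ℝ (Fin s))) p).source := by
    rw [← extChartAt_source (𝓘(ℝ, ℝ).prod (𝓡 s))]
    exact (extChartAt _ p).map_target hz
  have hf₀ (x : F) : f x ≠ 0 := (hpos x).ne'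
  have hric := h _ _ (isTimelike_mfderiv_extChartAt_symm hf₀ hz) _
    (IsManifold.chart_mem_maximalAtlas p) hsource
  rw [ricci_staticMetric_mfderiv_inl hf hf₀ hz] at hric
  exact nonneg_of_mul_nonneg_right hric (hpos _)

end StaticMetric

section MaximumOfLapse

variable {s : ℕ} {F : Type*} [TopologicalSpace F] [ChartedSpace (EuclideanSpace ℝ (Fin s)) F]
  [IsManifold (𝓡 s) ∞ F] {t₁ t₂ : EReal}
  {gF : Bundle.ContMDiffRiemannianMetric (𝓡 s) ∞ (EuclideanSpace ℝ (Fin s))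
    (fun x : F => TangentSpace (𝓡 s) x)} {f : F → ℝ} {x₀ : F}

theorem TimelikeConvergenceCondition.eventually_eq_of_forall_le
    (h : TimelikeConvergenceCondition (staticBasis s) (𝓘(ℝ, ℝ).prod (𝓡 s))
      (staticMetric t₁ t₂ f gF)) (hf : ContMDiff (𝓡 s) 𝓘(ℝ, ℝ) 2 f) (hpos : ∀ x, 0 < f x)
    (ht : t₁ < t₂) (hmax : ∀ x, f x ≤ f x₀) : ∀ᶠ x in 𝓝 x₀, f x = f x₀ := by
  have hU := isOpen_extChartAt_target (I := 𝓡 s) x₀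
  have hcoord := eventually_eq_of_laplacianCoord_nonneg
    (hU.mem_nhds (mem_extChartAt_target (I := 𝓡 s) x₀))
    (fun y hy i j => ((contDiffOn_metricInChart gF x₀ i j).contDiffAt (hU.mem_nhds hy)).of_le
      (by simp))
    (fun y hy => posDef_metricInChart gF hy)
    (fun y hy => contDiffAt_comp_extChartAt_symm hf hy)
    (fun y hy => h.laplacianCoord_nonneg hf hpos ht hy)
    (fun y _ => by simpa using hmax _)
  filter_upwards [(continuousAt_extChartAt (I := 𝓡 s) x₀).eventually hcoord,
    extChartAt_source_mem_nhds (I := 𝓡 s) x₀] with x hx hxs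
  simpa only [Function.comp_apply, (extChartAt (𝓡 s) x₀).left_inv hxs, extChartAt_to_inv] using hx

theorem TimelikeConvergenceCondition.eq_of_forall_le [PreconnectedSpace F]
    (h : TimelikeConvergenceCondition (staticBasis s) (𝓘(ℝ, ℝ).prod (𝓡 s))
      (staticMetric t₁ t₂ f gF)) (hf : ContMDiff (𝓡 s) 𝓘(ℝ, ℝ) 2 f) (hpos : ∀ x, 0 < f x)
    (ht : t₁ < t₂) (hmax : ∀ x, f x ≤ f x₀) (x : F) : f x = f x₀ := by
  have hopen : IsOpen {x | f x = f x₀} := isOpen_iff_mem_nhds.2 fun a (ha : f a = f x₀) =>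
    (h.eventually_eq_of_forall_le hf hpos ht (ha ▸ hmax)).mono fun _ hx => hx.trans ha
  have hclopen : IsClopen {x | f x = f x₀} :=
    ⟨isClosed_eq hf.continuous continuous_const, hopen⟩
  exact Set.eq_univ_iff_forall.1 (hclopen.eq_univ ⟨x₀, rfl⟩) x

end MaximumOfLapse

end StaticSpacetime

theorem mainTheorem11_general {s : ℕ} {F : Type*} [TopologicalSpace F] [PreconnectedSpace F]
    [ChartedSpace (EuclideanSpace ℝ (Fin s)) F] [IsManifold (𝓡 s) ∞ F]
    (gF : Bundle.ContMDiffRiemannianMetric (𝓡 s) ∞ (EuclideanSpace ℝ (Fin s))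
      (fun x : F => TangentSpace (𝓡 s) x))
    (f : F → ℝ) (hf : ContMDiff (𝓡 s) 𝓘(ℝ, ℝ) 2 f) (hpos : ∀ x, 0 < f x)
    (t₁ t₂ : EReal) (ht : t₁ < t₂) :
    (StaticSpacetime.StrongEnergyCondition (StaticSpacetime.staticBasis s)
          (𝓘(ℝ, ℝ).prod (𝓡 s)) (StaticSpacetime.staticMetric t₁ t₂ f gF) ↔
      StaticSpacetime.TimelikeConvergenceCondition (StaticSpacetime.staticBasis s)
          (𝓘(ℝ, ℝ).prod (𝓡 s)) (StaticSpacetime.staticMetric t₁ t₂ f gF)) ∧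
    (StaticSpacetime.StrongEnergyCondition (StaticSpacetime.staticBasis s)
          (𝓘(ℝ, ℝ).prod (𝓡 s)) (StaticSpacetime.staticMetric t₁ t₂ f gF) →
      ∀ x₀, (∀ x, f x ≤ f x₀) → ∀ x, f x = f x₀) := by
  have hiff := StaticSpacetime.strongEnergyCondition_iff_timelikeConvergenceCondition
    (b := StaticSpacetime.staticBasis s) (g := StaticSpacetime.staticMetric t₁ t₂ f gF)
    (fun _ => StaticSpacetime.staticMetric_symm)
    (StaticSpacetime.exists_isTimelike_staticMetric fun x => (hpos x).ne')
  exact ⟨hiff, fun h _ hmax => (hiff.1 h).eq_of_forall_le hf hpos ht hmax⟩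

theorem mainTheorem11 {s : ℕ} {F : Type*} [TopologicalSpace F] [T2Space F] [ConnectedSpace F]
    [CompactSpace F] [ChartedSpace (EuclideanSpace ℝ (Fin s)) F] [IsManifold (𝓡 s) ∞ F]
    (gF : Bundle.ContMDiffRiemannianMetric (𝓡 s) ∞ (EuclideanSpace ℝ (Fin s))
      (fun x : F => TangentSpace (𝓡 s) x))
    (f : F → ℝ) (hf : ContMDiff (𝓡 s) 𝓘(ℝ, ℝ) ∞ f) (hpos : ∀ x, 0 < f x)
    (t₁ t₂ : EReal) (ht : t₁ < t₂) :
    (StaticSpacetime.StrongEnergyCondition (StaticSpacetime.staticBasis s)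
          (𝓘(ℝ, ℝ).prod (𝓡 s)) (StaticSpacetime.staticMetric t₁ t₂ f gF) ↔
      StaticSpacetime.TimelikeConvergenceCondition (StaticSpacetime.staticBasis s)
          (𝓘(ℝ, ℝ).prod (𝓡 s)) (StaticSpacetime.staticMetric t₁ t₂ f gF)) ∧
    (StaticSpacetime.StrongEnergyCondition (StaticSpacetime.staticBasis s)
          (𝓘(ℝ, ℝ).prod (𝓡 s)) (StaticSpacetime.staticMetric t₁ t₂ f gF) →
      ∃ c : ℝ, 0 < c ∧ ∀ x : F, f x = c) := by
  obtain ⟨hiff, hconst⟩ := mainTheorem11_general gF f (hf.of_le ENat.LEInfty.out) hpos t₁ t₂ ht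
  obtain ⟨x₀, -, hx₀⟩ := isCompact_univ.exists_isMaxOn Set.univ_nonempty hf.continuous.continuousOn
  exact ⟨hiff, fun h => ⟨f x₀, hpos x₀, hconst h x₀ fun x => hx₀ (Set.mem_univ x)⟩⟩
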